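/- Let $d\in\mathbb N$, let $\|\cdot\|$ be any norm on $\mathbb R^d$, let $S$ be a finite set, and let $(\Omega,\mathcal A,P)$ be a probability space. Consider the iteration $$x_{n+1}=x_n+a(n)\bigl(F(x_n,Y_n)-x_n+M_{n+1}(x_n)\bigr),\qquad n\ge 0,$$ with a random initial vector $x_0$ in $\mathbb R^d$, $S$-valued random variables $Y_n$, $\mathbb R^d$-valued random variables $M_n(x)$ ($n\ge 0$, $x\in\mathbb R^d$), and a map $F=(F^1,\dots,F^d):\mathbb R^d\times S\to\mathbb R^d$. Put $\mathcal F_n=\sigma(x_0,\,Y_m,\,M_m(x):\ x\in\mathbb R^d,\ m\le n)$. Assume the following. 1. (Stepsizes) $a(n)\ge 0$, $a(n)\to 0$, $\sum_n a(n)=\infty$, $a$ is eventually non-increasing, and there are $d_1,d_3>0$ and $d_2\in(0,1]$ with $d_1/n\le a(n)\le d_3\,n^{-d_2}$ for all sufficiently large $n$. 2. (Markov noise) For each $w\in\mathbb R^d$, $p_w(\cdot|\cdot)$ is the transition probability of an irreducible Markov chain on $S$ with stationary distribution $\pi_w$; for some $L_1>0$, $\sum_{j\in S}|p_w(j|i)-p_v(j|i)|\le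 L_1\|w-v\|$ for all $i\in S$ and $w,v\in\mathbb R^d$; and $P(Y_{n+1}=j\mid Y_m,x_m,\,m\le n)=p_{x_n}(j|Y_n)$ a.s. for all $n\ge 0$, $j\in S$. 3. (Martingale differences) $E[M_{n+1}(x)\mid\mathcal F_n]=0$ a.s. for every $x\in\mathbb R^d$ and $n\ge0$; and the same holds along the iterates: for every $n\ge 0$, $M_{n+1}(x_n)$ is $\mathcal F_{n+1}$-measurable and $E[M_{n+1}(x_n)\mathbf 1\{\|x_n\|\le R\}\mid\mathcal F_n]=0$ a.s. for every $R$ (if $x_0$ is integrable, this says $E[M_{n+1}(x_n)\mid\mathcal F_n]=0$ a.s.). For some $K_0>0$, almost surely, $|M_{n+1}^\ell(x)|\le K_0(1+\|x\|)$ for all $n\ge 0$, $x\in\mathbb R^d$, $1\le \ell\le d$. 4. (Contraction) For some $\alpha\in(0,1)$, $\bigl\|\sum_{i\in S}\pi_w(i)(F(x,i)-F(z,i))\bigr\|\le\alpha\|x-z\|$ for all $x,z,w\in\mathbb R^d$, and there is $x^*\in\mathbb R^d$ with $\sum_{i\in S}\pi_w(i)F(x^*,i)=x^*$ for all $w\in\mathbb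 R^d$. 5. (Regularity and growth) For some $L_3>0$, $|F^\ell(x,i)-F^\ell(z,i)|\le L_3\|x-z\|$ for all $i\in S$, $1\le\ell\le d$ and $x,z\in\mathbb R^d$; and for some $K$, almost surely, $\|F(x,Y_n)+M_{n+1}(x)\|\le K+\alpha\|x\|$ for all $n\ge0$ and $x\in\mathbb R^d$, with the same $\alpha$ as in 4. Then $x_n\to x^*$ almost surely. -/

import Mathlib

open MeasureTheory Filter Topology
open scoped Matrix

/-- The `σ`-field `𝓕ₙ = σ(x₀, Yₘ, Mₘ(v) : v ∈ ℝᵈ, m ≤ n)`. -/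
abbrev noiseSigma {Ω S : Type*} {d : ℕ} [MeasurableSpace S]
    (x₀ : Ω → Fin d → ℝ) (Y : ℕ → Ω → S) (M : ℕ → (Fin d → ℝ) → Ω → Fin d → ℝ) (n : ℕ) :
    MeasurableSpace Ω :=
  MeasurableSpace.comap x₀ inferInstance ⊔
    (⨆ m ≤ n, MeasurableSpace.comap (Y m) inferInstance) ⊔
    (⨆ m ≤ n, ⨆ v : Fin d → ℝ, MeasurableSpace.comap (M m v) inferInstance)

/-- The `σ`-field `σ(Yₘ, xₘ : m ≤ n)`. -/
abbrev chainSigma {Ω S : Type*} {d : ℕ} [MeasurableSpace S]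
    (Y : ℕ → Ω → S) (x : ℕ → Ω → Fin d → ℝ) (n : ℕ) : MeasurableSpace Ω :=
  ⨆ m ≤ n, (MeasurableSpace.comap (Y m) inferInstance ⊔
    MeasurableSpace.comap (x m) inferInstance)

/-- The row vector `q` is a stationary probability distribution of the transition matrix `P`. -/
def IsStationaryDistribution {S : Type*} [Fintype S] (P : Matrix S S ℝ) (q : S → ℝ) : Prop :=
  q ∈ stdSimplex ℝ S ∧ q ᵥ* P = q

/-- The conditions on the stepsizes: non-negative, tending to zero, with divergent sum,
eventually non-increasing, `Ω(1/n)`, and `O((1/n) ^ d₂)` for some `0 < d₂ ≤ 1`. -/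
structure IsStepsize (a : ℕ → ℝ) : Prop where
  nonneg : ∀ n, 0 ≤ a n
  tendsto_zero : Tendsto a atTop (𝓝 0)
  not_summable : ¬ Summable a
  eventually_antitone : ∃ N : ℕ, ∀ n ≥ N, a (n + 1) ≤ a n
  lower : ∃ d₁ : ℝ, 0 < d₁ ∧ ∃ N : ℕ, ∀ n ≥ N, d₁ / (n : ℝ) ≤ a n
  upper : ∃ d₂ : ℝ, 0 < d₂ ∧ d₂ ≤ 1 ∧ ∃ d₃ : ℝ, 0 < d₃ ∧
    ∃ N : ℕ, ∀ n ≥ N, a n ≤ d₃ * (1 / (n : ℝ)) ^ d₂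

/-! Write `h w = ∑ i, π w i • F w i`. Testing the contraction hypothesis at parameter `w` against
the common fixed point gives `nrm (h w - xstar) ≤ α * nrm (w - xstar)`, and the iteration is the
relaxation towards `h` perturbed by the noise `η n = F (x n) (Y n) - h (x n) + M (n+1) (x n)`. If
`e` is the running average of `η` with the same weights, then `x - e` obeys a noiseless recursion
that contracts up to a multiple of `e`. So everything reduces to `e → 0` almost surely
(`tendsto_of_runningAverage_noise`).

The growth bound keeps each path bounded, by a random constant; the noise is therefore treated on
the event of staying in a fixed ball, for countably many radii. The steps need not be square
summable, so martingale convergence is replaced by concentration: running averages of bounded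
martingale differences are sub-Gaussian with variance proxy `O(n ^ (-δ))`, and Borel–Cantelli
applies (`ae_tendsto_runningAverage`).

The Markov part is handled by the Poisson equation `V - p V = F - h`. It splits into a martingale
difference, an increment of a bounded sequence (summation by parts), and the drift of `V` along the
slowly moving iterates (`tendsto_runningAverage_poisson`). -/

/-! ### Deterministic running averages -/

/-- The exponentially discounted average of `η` with weights `a`, started at zero. -/
def runningAverage (a η : ℕ → ℝ) : ℕ → ℝ
  | 0 => 0
  | n + 1 => (1 - a n) * runningAverage a η n + a n * η n

theorem runningAverage_add (a η ξ : ℕ → ℝ) (n : ℕ) :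
    runningAverage a (fun k => η k + ξ k) n = runningAverage a η n + runningAverage a ξ n := by
  induction n with
  | zero => simp [runningAverage]
  | succ n ih => simp only [runningAverage, ih]; ring

/-- A nonnegative sequence with a contracting recursion driven by a null sequence tends to zero. -/
theorem tendsto_zero_of_le_contraction {b r u : ℕ → ℝ} (hb0 : ∀ n, 0 ≤ b n)
    (hb1 : ∀ᶠ n in atTop, b n ≤ 1) (hbs : ¬ Summable b) (hr : Tendsto r atTop (𝓝 0))
    (hu0 : ∀ᶠ n in atTop, 0 ≤ u n)
    (hu : ∀ᶠ n in atTop, u (n + 1) ≤ (1 - b n) * u n + b n * r n) :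
    Tendsto u atTop (𝓝 0) := by
  rw [Metric.tendsto_atTop]
  intro ε hε
  obtain ⟨N, hN⟩ := eventually_atTop.1
    (hb1.and (hu0.and (hu.and (hr.eventually (gt_mem_nhds (half_pos hε))))))
  -- Since `r < ε / 2` from `N` on, the excess over `ε / 2` shrinks by `1 - b ≤ exp (-b)` at each
  -- step.
  have key : ∀ k, u (N + k) - ε / 2 ≤
      Real.exp (-∑ i ∈ Finset.range k, b (N + i)) * |u N| := by
    intro k
    induction k with
    | zero => simpa using (by linarith [le_abs_self (u N)] : u N ≤ |u N| + ε / 2)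
    | succ k ih =>
      obtain ⟨h1, -, h3, h4⟩ := hN (N + k) (by omega)
      have h0 := hb0 (N + k)
      have hexp := Real.one_sub_le_exp_neg (b (N + k))
      rw [Finset.sum_range_succ, neg_add, Real.exp_add]
      have e1 : u (N + (k + 1)) - ε / 2 ≤ (1 - b (N + k)) * (u (N + k) - ε / 2) := by
        have : b (N + k) * r (N + k) ≤ b (N + k) * (ε / 2) :=
          mul_le_mul_of_nonneg_left h4.le h0
        have h3' : u (N + (k + 1)) ≤ (1 - b (N + k)) * u (N + k) + b (N + k) * r (N + k) := h3
        linarith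
      calc _ ≤ _ := e1
        _ ≤ (1 - b (N + k)) * (Real.exp (-∑ i ∈ Finset.range k, b (N + i)) * |u N|) :=
          mul_le_mul_of_nonneg_left ih (by linarith)
        _ ≤ Real.exp (-b (N + k)) * (Real.exp (-∑ i ∈ Finset.range k, b (N + i)) * |u N|) :=
          mul_le_mul_of_nonneg_right hexp (by positivity)
        _ = _ := by ring
  have hns : ¬ Summable fun i => b (N + i) := by
    simpa only [add_comm N] using mt (summable_nat_add_iff N).1 hbs
  have hdiv := (not_summable_iff_tendsto_nat_atTop_of_nonneg (fun i => hb0 (N + i))).1 hns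
  have hlim : Tendsto (fun k => Real.exp (-∑ i ∈ Finset.range k, b (N + i)) * |u N|) atTop
      (𝓝 0) := by
    simpa using (Real.tendsto_exp_neg_atTop_nhds_zero.comp hdiv).mul_const |u N|
  obtain ⟨k₀, hk₀⟩ := eventually_atTop.1 (hlim.eventually (gt_mem_nhds (half_pos hε)))
  refine ⟨N + k₀, fun n hn => ?_⟩
  obtain ⟨k, rfl⟩ := Nat.exists_eq_add_of_le (show N ≤ n by omega)
  have h1 := key k
  have h2 := hk₀ k (by omega)
  have h3 := (hN (N + k) (by omega)).2.1
  rw [Real.dist_eq, sub_zero, abs_of_nonneg h3]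
  linarith

theorem tendsto_runningAverage_of_tendsto {a η : ℕ → ℝ} (ha0 : ∀ n, 0 ≤ a n)
    (ha1 : ∀ᶠ n in atTop, a n ≤ 1) (has : ¬ Summable a) (hη : Tendsto η atTop (𝓝 0)) :
    Tendsto (runningAverage a η) atTop (𝓝 0) := by
  rw [tendsto_zero_iff_abs_tendsto_zero]
  refine tendsto_zero_of_le_contraction (r := fun n => |η n|) ha0 ha1 has (by simpa using hη.abs)
    (Eventually.of_forall fun n => abs_nonneg _) ?_
  filter_upwards [ha1] with n h1
  simp only [Function.comp, runningAverage]
  refine (abs_add_le _ _).trans (le_of_eq ?_)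
  rw [abs_mul, abs_mul, abs_of_nonneg (sub_nonneg.2 h1), abs_of_nonneg (ha0 n)]

/-- Summation by parts: increments of a bounded sequence average out when the weights are
eventually non-increasing. -/
theorem tendsto_runningAverage_of_increments {a W : ℕ → ℝ} (ha0 : ∀ n, 0 ≤ a n)
    (ha : Tendsto a atTop (𝓝 0)) (has : ¬ Summable a) (hanti : ∀ᶠ n in atTop, a (n + 1) ≤ a n)
    {C : ℝ} (hW : ∀ n, |W n| ≤ C) :
    Tendsto (runningAverage a fun n => W n - W (n + 1)) atTop (𝓝 0) := by
  set e := runningAverage a fun n => W n - W (n + 1) with he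
  have ha1 : ∀ᶠ n in atTop, a n ≤ 1 := ha.eventually (ge_mem_nhds one_pos)
  have hC : 0 ≤ C := (abs_nonneg _).trans (hW 0)
  -- Adding `a n * W n` absorbs the increment and leaves an error `(a n - a (n + 1)) * C`; the extra
  -- term `C * a n` makes that error telescope.
  have hu : Tendsto (fun n => |e n + a n * W n| + C * a n) atTop (𝓝 0) := by
    refine tendsto_zero_of_le_contraction (r := fun n => 2 * C * a n) ha0 ha1 has
      (by simpa using ha.const_mul (2 * C))
      (Eventually.of_forall fun n => add_nonneg (abs_nonneg _) (mul_nonneg hC (ha0 n))) ?_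
    filter_upwards [ha1, hanti] with n h1 h2
    have hrec : e (n + 1) + a (n + 1) * W (n + 1) = (1 - a n) * (e n + a n * W n)
        + a n * (a n * W n) + (a (n + 1) - a n) * W (n + 1) := by
      simp only [he, runningAverage]; ring
    have b1 : |(1 - a n) * (e n + a n * W n)| = (1 - a n) * |e n + a n * W n| := by
      rw [abs_mul, abs_of_nonneg (sub_nonneg.2 h1)]
    have b2 : |a n * (a n * W n)| ≤ a n * (a n * C) := by
      rw [abs_mul, abs_mul, abs_of_nonneg (ha0 n)]
      exact mul_le_mul_of_nonneg_left (mul_le_mul_of_nonneg_left (hW n) (ha0 n)) (ha0 n)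
    have b3 : |(a (n + 1) - a n) * W (n + 1)| ≤ (a n - a (n + 1)) * C := by
      rw [abs_mul, abs_sub_comm, abs_of_nonneg (sub_nonneg.2 h2)]
      exact mul_le_mul_of_nonneg_left (hW _) (sub_nonneg.2 h2)
    rw [hrec]
    have := abs_add_three ((1 - a n) * (e n + a n * W n)) (a n * (a n * W n))
      ((a (n + 1) - a n) * W (n + 1))
    nlinarith
  have haW : Tendsto (fun n => a n * W n) atTop (𝓝 0) := by
    refine squeeze_zero_norm (a := fun n => a n * C) (fun n => ?_) (by simpa using ha.mul_const C)
    rw [Real.norm_eq_abs, abs_mul, abs_of_nonneg (ha0 n)]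
    exact mul_le_mul_of_nonneg_left (hW n) (ha0 n)
  have hg : Tendsto (fun n => e n + a n * W n) atTop (𝓝 0) :=
    squeeze_zero_norm (fun n => by
      simpa using mul_nonneg hC (ha0 n)) hu
  simpa using hg.sub haW

/-! ### Decay of the variance proxy -/

/-- The recursion satisfied by the variance proxy of a running average of martingale differences
bounded by `C`. -/
def varianceProxy (a : ℕ → ℝ) (C : ℝ) : ℕ → ℝ
  | 0 => 0
  | n + 1 => (1 - a n) ^ 2 * varianceProxy a C n + (a n) ^ 2 * C ^ 2

theorem varianceProxy_nonneg (a : ℕ → ℝ) (C : ℝ) (n : ℕ) : 0 ≤ varianceProxy a C n := by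
  induction n with
  | zero => simp [varianceProxy]
  | succ n ih => simp only [varianceProxy]; positivity

/-- Bernoulli's inequality `(1 + 1/t) ^ δ ≤ 1 + δ/t`, inverted. -/
theorem rpow_neg_sub_rpow_neg_succ_le {δ : ℝ} (h0 : 0 ≤ δ) (h1 : δ ≤ 1) {t : ℝ} (ht : 0 < t) :
    t ^ (-δ) - (t + 1) ^ (-δ) ≤ δ / t * t ^ (-δ) := by
  have hb := rpow_one_add_le_one_add_mul_self (s := 1 / t) (by
    have : 0 < 1 / t := by positivity
    linarith) h0 h1
  have hpos : 0 < (1 + 1 / t) ^ δ := by positivity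
  have e : (t + 1) ^ (-δ) = t ^ (-δ) * ((1 + 1 / t) ^ δ)⁻¹ := by
    rw [show t + 1 = t * (1 + 1 / t) by field_simp, Real.mul_rpow ht.le (by positivity),
      Real.rpow_neg (by positivity : (0 : ℝ) ≤ 1 + 1 / t)]
  have hi : 1 - δ / t ≤ ((1 + 1 / t) ^ δ)⁻¹ := by
    rw [← one_div, le_div_iff₀ hpos]
    rcases le_total (1 - δ / t) 0 with h | h
    · nlinarith
    · have : (1 - δ / t) * (1 + 1 / t) ^ δ ≤ (1 - δ / t) * (1 + δ * (1 / t)) :=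
        mul_le_mul_of_nonneg_left hb h
      have e2 : δ * (1 / t) = δ / t := by ring
      rw [e2] at this
      nlinarith [sq_nonneg (δ / t)]
  rw [e]
  have : 0 < t ^ (-δ) := by positivity
  nlinarith

/-- Contraction at rate `a n` beats both the injected variance `a n ^ 2 * C ^ 2` and the relative
decrease `δ / n` of the target: each costs at most half of the gain `a n * A * n ^ (-δ)`. -/
theorem varianceProxy_le_rpow {a : ℕ → ℝ} (ha : IsStepsize a) (C : ℝ) :
    ∃ δ : ℝ, 0 < δ ∧ ∃ A : ℝ, 0 < A ∧
      ∀ᶠ n : ℕ in atTop, varianceProxy a C n ≤ A * (n : ℝ) ^ (-δ) := by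
  obtain ⟨d₁, hd₁, N₁, hN₁⟩ := ha.lower
  obtain ⟨d₂, hd₂, hd₂', d₃, hd₃, N₂, hN₂⟩ := ha.upper
  obtain ⟨N₃, hN₃⟩ := eventually_atTop.1 (ha.tendsto_zero.eventually (ge_mem_nhds one_pos))
  -- `δ ≤ d₂` gives `a n ≤ d₃ * n ^ (-δ)`, and `δ ≤ d₁ / 2` gives `δ / n ≤ a n / 2`.
  set δ := min d₂ (d₁ / 2) with hδ
  have hδ0 : 0 < δ := lt_min hd₂ (by positivity)
  have hδ1 : δ ≤ 1 := (min_le_left _ _).trans hd₂'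
  have hδ2 : δ ≤ d₁ / 2 := min_le_right _ _
  set N := max (max N₁ N₂) (max N₃ 1) with hN
  have hNpos : (0 : ℝ) < N := by
    have : 1 ≤ N := by omega
    exact_mod_cast this
  -- The first term serves the induction step, the second the base case, and `1` ensures positivity.
  set A := 2 * C ^ 2 * d₃ + varianceProxy a C N * (N : ℝ) ^ δ + 1 with hA
  have hV := varianceProxy_nonneg a C N
  have hA0 : 0 < A := by positivity
  have hA2 : 2 * C ^ 2 * d₃ ≤ A := by
    have : 0 ≤ varianceProxy a C N * (N : ℝ) ^ δ := by positivity
    linarith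
  refine ⟨δ, hδ0, A, hA0, eventually_atTop.2 ⟨N, fun n hn => ?_⟩⟩
  induction n, hn using Nat.le_induction with
  | base =>
    have : varianceProxy a C N = varianceProxy a C N * (N : ℝ) ^ δ * (N : ℝ) ^ (-δ) := by
      rw [mul_assoc, ← Real.rpow_add hNpos]; simp
    rw [this]
    refine mul_le_mul_of_nonneg_right ?_ (by positivity)
    have : 0 ≤ 2 * C ^ 2 * d₃ := by positivity
    linarith
  | succ n hn ih =>
    have hn0 : (1 : ℝ) ≤ n := by
      have : 1 ≤ n := by omega
      exact_mod_cast this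
    have hnpos : (0 : ℝ) < n := by linarith
    have h0 := ha.nonneg n
    have h1 := hN₃ n (by omega)
    have hlow := hN₁ n (by omega)
    have hup : a n ≤ d₃ * (n : ℝ) ^ (-δ) := by
      refine (hN₂ n (by omega)).trans (mul_le_mul_of_nonneg_left ?_ hd₃.le)
      rw [one_div, Real.inv_rpow hnpos.le, ← Real.rpow_neg hnpos.le]
      exact Real.rpow_le_rpow_of_exponent_le hn0 (neg_le_neg (min_le_left _ _))
    have hdec := rpow_neg_sub_rpow_neg_succ_le hδ0.le hδ1 hnpos
    set q := (n : ℝ) ^ (-δ) with hq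
    have hq0 : 0 < q := by positivity
    have hVn := varianceProxy_nonneg a C n
    push_cast
    simp only [varianceProxy]
    have s1 : (1 - a n) ^ 2 * varianceProxy a C n ≤ (1 - a n) * (A * q) := by
      have : (1 - a n) ^ 2 ≤ 1 - a n := by nlinarith
      exact mul_le_mul this ih hVn (by linarith)
    have s2 : (a n) ^ 2 * C ^ 2 ≤ a n * (A * q / 2) := by
      have h5 : a n * C ^ 2 ≤ d₃ * q * C ^ 2 := mul_le_mul_of_nonneg_right hup (sq_nonneg C)
      have h6 : d₃ * q * C ^ 2 ≤ A * q / 2 := by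
        have := mul_le_mul_of_nonneg_right hA2 hq0.le
        linarith
      calc (a n) ^ 2 * C ^ 2 = a n * (a n * C ^ 2) := by ring
        _ ≤ _ := mul_le_mul_of_nonneg_left (h5.trans h6) h0
    have s3 : A * q - A * ((n : ℝ) + 1) ^ (-δ) ≤ a n * (A * q / 2) := by
      have h7 : δ / n ≤ a n / 2 := by
        have : δ / n ≤ d₁ / 2 / n := div_le_div_of_nonneg_right hδ2 hnpos.le
        have e : d₁ / 2 / (n : ℝ) = d₁ / n / 2 := by ring
        linarith
      have h8 : q - ((n : ℝ) + 1) ^ (-δ) ≤ a n / 2 * q :=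
        hdec.trans (mul_le_mul_of_nonneg_right h7 hq0.le)
      nlinarith [mul_le_mul_of_nonneg_left h8 hA0.le]
    linarith

theorem summable_exp_neg_mul_rpow {c δ : ℝ} (hc : 0 < c) (hδ : 0 < δ) :
    Summable fun n : ℕ => Real.exp (-c * (n : ℝ) ^ δ) := by
  -- With the variable `n ^ δ`, the exponent `-(2 / δ)` yields the summable comparison `n ^ (-2)`.
  have h := (isLittleO_exp_neg_mul_rpow_atTop hc (-(2 / δ))).comp_tendsto
    ((tendsto_rpow_atTop hδ).comp tendsto_natCast_atTop_atTop)
  refine summable_of_isBigO_nat (g := fun n : ℕ => (n : ℝ) ^ (-(2 : ℝ)))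
    (Real.summable_nat_rpow.2 (by norm_num)) (h.isBigO.congr_right fun n => ?_)
  simp only [Function.comp]
  rw [← Real.rpow_mul (Nat.cast_nonneg n)]
  congr 1
  field_simp

/-! ### Concentration for averaged martingale differences -/

section Stochastic

variable {Ω : Type*} {G : ℕ → MeasurableSpace Ω} {ε : ℕ → Ω → ℝ}

theorem measurable_runningAverage (hG : Monotone G) (hε : ∀ n, Measurable[G (n + 1)] (ε n))
    (a : ℕ → ℝ) (n : ℕ) : Measurable[G n] fun ω => runningAverage a (fun k => ε k ω) n := by
  induction n with
  | zero => exact @measurable_const _ _ _ (G 0) _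
  | succ n ih =>
    have h1 : Measurable[G (n + 1)] fun ω => (1 - a n) * runningAverage a (fun k => ε k ω) n :=
      (ih.mono (hG n.le_succ) le_rfl).const_mul _
    have h2 : Measurable[G (n + 1)] fun ω => a n * ε n ω := (hε n).const_mul _
    exact h1.add h2

variable [mΩ : MeasurableSpace Ω] {μ : Measure Ω} {C : ℝ}

theorem runningAverage_bounded (hC : ∀ n, ∀ᵐ ω ∂μ, |ε n ω| ≤ C) (a : ℕ → ℝ) (n : ℕ) :
    ∃ B, ∀ᵐ ω ∂μ, |runningAverage a (fun k => ε k ω) n| ≤ B := by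
  induction n with
  | zero => exact ⟨0, by simp [runningAverage]⟩
  | succ n ih =>
    obtain ⟨B, hB⟩ := ih
    refine ⟨|1 - a n| * B + |a n| * C, ?_⟩
    filter_upwards [hB, hC n] with ω h1 h2
    refine (abs_add_le _ _).trans ?_
    rw [abs_mul, abs_mul]
    gcongr

variable [IsProbabilityMeasure μ]

theorem integral_mul_eq_zero_of_condExp_eq_zero {m : MeasurableSpace Ω} (hm : m ≤ mΩ)
    {Z ε : Ω → ℝ} (hZ : Measurable[m] Z) {B : ℝ} (hB : ∀ᵐ ω ∂μ, |Z ω| ≤ B)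
    (hε : Integrable ε μ) (h0 : μ[ε | m] =ᵐ[μ] 0) : ∫ ω, Z ω * ε ω ∂μ = 0 := by
  have h1 := condExp_stronglyMeasurable_mul_of_bound hm
    hZ.stronglyMeasurable hε B (by simpa using hB)
  have h2 : ∫ ω, (Z * ε) ω ∂μ = ∫ ω, (μ[Z * ε | m]) ω ∂μ := (integral_condExp hm).symm
  have h3 : μ[Z * ε | m] =ᵐ[μ] 0 := by
    filter_upwards [h1, h0] with ω e1 e2
    simp [e1, e2]
  rw [integral_congr_ae h3] at h2
  simpa using h2

theorem integrable_exp_runningAverage (hle : ∀ n, G n ≤ mΩ) (hG : Monotone G)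
    (hε : ∀ n, Measurable[G (n + 1)] (ε n)) (hC : ∀ n, ∀ᵐ ω ∂μ, |ε n ω| ≤ C) (a : ℕ → ℝ)
    (θ : ℝ) (n : ℕ) :
    Integrable (fun ω => Real.exp (θ * runningAverage a (fun k => ε k ω) n)) μ := by
  obtain ⟨B, hB⟩ := runningAverage_bounded hC a n
  refine Integrable.of_bound (C := Real.exp (|θ| * B)) ?_ ?_
  · exact (Real.measurable_exp.comp (((measurable_runningAverage hG hε a n).mono (hle n)
      le_rfl).const_mul θ)).aestronglyMeasurable
  · filter_upwards [hB] with ω h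
    rw [Real.norm_eq_abs, Real.abs_exp, Real.exp_le_exp]
    refine (le_abs_self _).trans ?_
    rw [abs_mul]
    gcongr

/-- Running averages of bounded martingale differences are sub-Gaussian. -/
theorem integral_exp_runningAverage_le (hle : ∀ n, G n ≤ mΩ) (hG : Monotone G)
    (hε : ∀ n, Measurable[G (n + 1)] (ε n)) (hC0 : 0 < C) (hC : ∀ n, ∀ᵐ ω ∂μ, |ε n ω| ≤ C)
    (h0 : ∀ n, μ[ε n | G n] =ᵐ[μ] 0) (a : ℕ → ℝ) (n : ℕ) (θ : ℝ) :
    ∫ ω, Real.exp (θ * runningAverage a (fun k => ε k ω) n) ∂μ ≤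
      Real.exp (θ ^ 2 * varianceProxy a C n / 2) := by
  induction n generalizing θ with
  | zero => simp [runningAverage, varianceProxy]
  | succ n ih =>
    set Z : Ω → ℝ := fun ω => Real.exp (θ * (1 - a n) * runningAverage a (fun k => ε k ω) n)
      with hZ
    have hZm : Measurable[G n] Z :=
      Real.measurable_exp.comp
        ((measurable_runningAverage hG hε a n).const_mul _)
    have hZi : Integrable Z μ := integrable_exp_runningAverage hle hG hε hC a _ n
    obtain ⟨B, hB⟩ := runningAverage_bounded hC a n
    have hZb : ∀ᵐ ω ∂μ, |Z ω| ≤ Real.exp (|θ * (1 - a n)| * B) := by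
      filter_upwards [hB] with ω h
      rw [hZ, Real.abs_exp, Real.exp_le_exp]
      refine (le_abs_self _).trans ?_
      rw [abs_mul]
      gcongr
    have hεi : Integrable (ε n) μ :=
      Integrable.of_bound (((hε n).mono (hle _) le_rfl).aestronglyMeasurable) C (hC n)
    have hZε := integral_mul_eq_zero_of_condExp_eq_zero (hle n) hZm hZb hεi (h0 n)
    have hZεi : Integrable (fun ω => Z ω * ε n ω) μ :=
      hεi.bdd_mul (hZm.mono (hle n) le_rfl).aestronglyMeasurable hZb
    set s := θ * a n * C with hs
    -- Hoeffding's argument: by convexity `exp (t * s) ≤ cosh s + t * sinh s` for `|t| ≤ 1`, and the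
    -- `sinh` term integrates to zero.
    have hpt : ∀ᵐ ω ∂μ, Real.exp (θ * runningAverage a (fun k => ε k ω) (n + 1)) ≤
        Real.cosh s * Z ω + Real.sinh s / C * (Z ω * ε n ω) := by
      filter_upwards [hC n] with ω h
      have e : θ * runningAverage a (fun k => ε k ω) (n + 1) =
          θ * (1 - a n) * runningAverage a (fun k => ε k ω) n + ε n ω / C * s := by
        simp only [runningAverage, hs]; field_simp
      have hb := Real.exp_mul_le_cosh_add_mul_sinh (t := ε n ω / C)
        (by rwa [abs_div, abs_of_pos hC0, div_le_one hC0]) s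
      rw [e, Real.exp_add]
      calc _ ≤ Z ω * (Real.cosh s + ε n ω / C * Real.sinh s) :=
            mul_le_mul_of_nonneg_left hb (Real.exp_pos _).le
        _ = _ := by ring
    calc _ ≤ ∫ ω, (Real.cosh s * Z ω + Real.sinh s / C * (Z ω * ε n ω)) ∂μ :=
          integral_mono_ae (integrable_exp_runningAverage hle hG hε hC a _ _)
            ((hZi.const_mul _).add (hZεi.const_mul _)) hpt
      _ = Real.cosh s * ∫ ω, Z ω ∂μ := by
          rw [integral_add (hZi.const_mul _) (hZεi.const_mul _), integral_const_mul,
            integral_const_mul, hZε, mul_zero, add_zero]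
      _ ≤ Real.exp (s ^ 2 / 2) * Real.exp ((θ * (1 - a n)) ^ 2 * varianceProxy a C n / 2) :=
          mul_le_mul (Real.cosh_le_exp_half_sq s) (ih _)
            (integral_nonneg fun ω => (Real.exp_pos _).le) (Real.exp_pos _).le
      _ = _ := by
          rw [← Real.exp_add]
          congr 1
          simp only [varianceProxy, hs]; ring

/-- Chernoff's bound for both tails, at the optimal parameter `θ = ± t / V`. -/
theorem measureReal_le_runningAverage (hle : ∀ n, G n ≤ mΩ) (hG : Monotone G)
    (hε : ∀ n, Measurable[G (n + 1)] (ε n)) (hC0 : 0 < C) (hC : ∀ n, ∀ᵐ ω ∂μ, |ε n ω| ≤ C)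
    (h0 : ∀ n, μ[ε n | G n] =ᵐ[μ] 0) (a : ℕ → ℝ) (n : ℕ) {V t : ℝ} (hV : 0 < V)
    (hVn : varianceProxy a C n ≤ V) (ht : 0 < t) :
    μ.real {ω | t ≤ |runningAverage a (fun k => ε k ω) n|} ≤ 2 * Real.exp (-(t ^ 2 / (2 * V))) := by
  have side : ∀ θ : ℝ, |θ| = t / V →
      μ.real {ω | Real.exp (t ^ 2 / V) ≤ Real.exp (θ * runningAverage a (fun k => ε k ω) n)} ≤
        Real.exp (-(t ^ 2 / (2 * V))) := by
    intro θ hθ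
    have hm := mul_meas_ge_le_integral_of_nonneg (μ := μ)
      (f := fun ω => Real.exp (θ * runningAverage a (fun k => ε k ω) n))
      (ae_of_all _ fun ω => (Real.exp_pos _).le)
      (integrable_exp_runningAverage hle hG hε hC a θ n) (Real.exp (t ^ 2 / V))
    have hi := hm.trans (integral_exp_runningAverage_le hle hG hε hC0 hC h0 a n θ)
    have hθ2 : θ ^ 2 = (t / V) ^ 2 := by rw [← sq_abs, hθ]
    have hle2 : Real.exp (θ ^ 2 * varianceProxy a C n / 2) ≤ Real.exp (t ^ 2 / (2 * V)) := by
      rw [Real.exp_le_exp, hθ2]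
      calc (t / V) ^ 2 * varianceProxy a C n / 2 ≤ (t / V) ^ 2 * V / 2 := by gcongr
        _ = _ := by field_simp
    have hi2 := hi.trans hle2
    rw [← le_div_iff₀' (Real.exp_pos _), ← Real.exp_sub] at hi2
    refine hi2.trans (le_of_eq ?_)
    congr 1
    field_simp
    ring
  have hsub : {ω | t ≤ |runningAverage a (fun k => ε k ω) n|} ⊆
      {ω | Real.exp (t ^ 2 / V) ≤ Real.exp (t / V * runningAverage a (fun k => ε k ω) n)} ∪
      {ω | Real.exp (t ^ 2 / V) ≤ Real.exp (-(t / V) * runningAverage a (fun k => ε k ω) n)} := by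
    intro ω hω
    have hpos : 0 < t / V := by positivity
    have e : t ^ 2 / V = t / V * t := by ring
    simp only [Set.mem_union, Set.mem_ofPred_eq, Real.exp_le_exp, e] at hω ⊢
    rcases le_abs.1 hω with h | h
    · exact Or.inl (mul_le_mul_of_nonneg_left h hpos.le)
    · right
      have := mul_le_mul_of_nonneg_left h hpos.le
      linarith
  have hpos : 0 < t / V := by positivity
  have s1 := side (t / V) (abs_of_pos hpos)
  have s2 := side (-(t / V)) (by rw [abs_neg, abs_of_pos hpos])
  calc _ ≤ _ := measureReal_mono hsub
    _ ≤ _ := measureReal_union_le _ _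
    _ ≤ _ := by linarith

/-- Running averages of bounded martingale differences vanish almost surely. -/
theorem ae_tendsto_runningAverage {a : ℕ → ℝ} (ha : IsStepsize a) (hle : ∀ n, G n ≤ mΩ)
    (hG : Monotone G) (hε : ∀ n, Measurable[G (n + 1)] (ε n))
    (hC : ∀ n, ∀ᵐ ω ∂μ, |ε n ω| ≤ C) (h0 : ∀ n, μ[ε n | G n] =ᵐ[μ] 0) :
    ∀ᵐ ω ∂μ, Tendsto (runningAverage a fun k => ε k ω) atTop (𝓝 0) := by
  -- The exponential moment bound divides by the constant, while `C` may vanish or be negative.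
  have hC0 : 0 < |C| + 1 := by positivity
  have hC' : ∀ n, ∀ᵐ ω ∂μ, |ε n ω| ≤ |C| + 1 := fun n => by
    filter_upwards [hC n] with ω h
    linarith [le_abs_self C]
  obtain ⟨δ, hδ, A, hA, hev⟩ := varianceProxy_le_rpow ha (|C| + 1)
  have hsmall : ∀ t : ℝ, 0 < t → ∀ᵐ ω ∂μ, ∀ᶠ n in atTop,
      |runningAverage a (fun k => ε k ω) n| < t := by
    intro t ht
    have hbound : ∀ᶠ n : ℕ in atTop,
        ‖μ.real {ω | t ≤ |runningAverage a (fun k => ε k ω) n|}‖ ≤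
          2 * Real.exp (-(t ^ 2 / (2 * A)) * (n : ℝ) ^ δ) := by
      filter_upwards [hev, eventually_gt_atTop 0] with n hn hn0
      have hnpos : (0 : ℝ) < n := by exact_mod_cast hn0
      rw [Real.norm_of_nonneg measureReal_nonneg]
      refine (measureReal_le_runningAverage hle hG hε hC0 hC' h0 a n
        (V := A * (n : ℝ) ^ (-δ)) (by positivity) hn ht).trans (le_of_eq ?_)
      rw [Real.rpow_neg hnpos.le]
      have : (n : ℝ) ^ δ ≠ 0 := by positivity
      congr 2
      field_simp
    have hsum : Summable fun n => μ.real {ω | t ≤ |runningAverage a (fun k => ε k ω) n|} :=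
      Summable.of_norm_bounded_eventually_nat
        ((summable_exp_neg_mul_rpow (c := t ^ 2 / (2 * A)) (by positivity) hδ).mul_left 2) hbound
    have hfin : ∑' n, μ {ω | t ≤ |runningAverage a (fun k => ε k ω) n|} ≠ ⊤ := by
      rw [← tsum_congr fun n => ofReal_measureReal (μ := μ)]
      exact hsum.tsum_ofReal_ne_top
    filter_upwards [ae_eventually_notMem hfin] with ω hω
    filter_upwards [hω] with n hn
    simpa using hn
  have hall : ∀ᵐ ω ∂μ, ∀ k : ℕ, ∀ᶠ n in atTop,
      |runningAverage a (fun k => ε k ω) n| < 1 / ((k : ℝ) + 1) :=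
    ae_all_iff.2 fun k => hsmall _ (by positivity)
  filter_upwards [hall] with ω hω
  rw [Metric.tendsto_nhds]
  intro t ht
  obtain ⟨k, hk⟩ := exists_nat_one_div_lt ht
  filter_upwards [hω k] with n hn
  rw [Real.dist_eq, sub_zero]
  exact hn.trans hk

end Stochastic

/-! ### Poisson equation for irreducible chains -/

section Poisson

variable {S : Type*} [Fintype S] [DecidableEq S]

/-- Vectors fixed by an irreducible stochastic matrix are constant. -/
theorem eq_of_mulVec_eq_self {P : Matrix S S ℝ} (hP : P ∈ Matrix.rowStochastic ℝ S)
    (hirr : P.IsIrreducible) {v : S → ℝ} (hv : P *ᵥ v = v) (i j : S) : v i = v j := by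
  rcases subsingleton_or_nontrivial S with hS | hS
  · rw [Subsingleton.elim i j]
  have hmax : ∃ m, ∀ k, v k ≤ v m := by
    have : Nonempty S := ⟨i⟩
    exact Finite.exists_max v
  obtain ⟨m, hm⟩ := hmax
  suffices h : ∀ k, v k = v m by rw [h i, h j]
  intro k
  obtain ⟨t, -, ht⟩ := (Matrix.isIrreducible_iff_exists_pow_pos hP.1).1 hirr m k
  have hPt : P ^ t ∈ Matrix.rowStochastic ℝ S := pow_mem hP t
  have hvt : (P ^ t) *ᵥ v = v := by
    clear ht hPt
    induction t with
    | zero => simp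
    | succ t ih => rw [pow_succ, ← Matrix.mulVec_mulVec, hv, ih]
  -- Maximum principle: an average of nonnegative gaps below the maximum vanishes, so the gap at
  -- `k`, which has positive weight, is zero.
  have hsum : ∑ l, (P ^ t) m l * (v m - v l) = 0 := by
    simp only [mul_sub, Finset.sum_sub_distrib, ← Finset.sum_mul,
      Matrix.sum_row_of_mem_rowStochastic hPt, one_mul]
    rw [sub_eq_zero]
    exact (congrFun hvt m).symm
  have h0 := (Finset.sum_eq_zero_iff_of_nonneg fun l _ =>
    mul_nonneg (hPt.1 m l) (sub_nonneg.2 (hm l))).1 hsum k (Finset.mem_univ k)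
  rcases mul_eq_zero.1 h0 with h | h
  · exact absurd h ht.ne'
  · linarith

/-- The matrix `1 - P + 𝟙 uᵀ` with `u` the uniform distribution; it inverts `1 - P` on the vectors
of stationary mean zero. -/
noncomputable def resolventMatrix (P : Matrix S S ℝ) : Matrix S S ℝ :=
  1 - P + Matrix.of fun _ _ => (Fintype.card S : ℝ)⁻¹

/-- The solution of the Poisson equation for the transition matrix `P` and the forcing `f`. -/
noncomputable def poissonSolution (P : Matrix S S ℝ) (f : S → ℝ) : S → ℝ :=
  (resolventMatrix P)⁻¹ *ᵥ f

theorem resolventMatrix_mulVec (P : Matrix S S ℝ) (v : S → ℝ) (i : S) :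
    (resolventMatrix P *ᵥ v) i = v i - (P *ᵥ v) i + (Fintype.card S : ℝ)⁻¹ * ∑ j, v j := by
  rw [resolventMatrix, Matrix.add_mulVec, Matrix.sub_mulVec, Matrix.one_mulVec]
  simp [Matrix.mulVec, dotProduct, Finset.mul_sum]

/-- Stationarity kills `1 - P`, so only the rank-one part survives. -/
theorem stationary_dotProduct_resolventMatrix {P : Matrix S S ℝ} {q : S → ℝ}
    (hq : IsStationaryDistribution P q) (v : S → ℝ) :
    q ⬝ᵥ (resolventMatrix P *ᵥ v) = (Fintype.card S : ℝ)⁻¹ * ∑ j, v j := by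
  have h1 : q ⬝ᵥ (P *ᵥ v) = q ⬝ᵥ v := by rw [Matrix.dotProduct_mulVec, hq.2]
  have h2 : resolventMatrix P *ᵥ v =
      v - P *ᵥ v + fun _ => (Fintype.card S : ℝ)⁻¹ * ∑ j, v j := by
    ext i; simp [resolventMatrix_mulVec]
  rw [h2, dotProduct_add, dotProduct_sub, h1, sub_self, zero_add]
  simp only [dotProduct, ← Finset.sum_mul, hq.1.2, one_mul]

/-- Pairing a kernel vector with `q` shows that its entries sum to zero. It is then fixed by `P`,
hence constant, hence zero. -/
theorem isUnit_det_resolventMatrix {P : Matrix S S ℝ} (hP : P ∈ Matrix.rowStochastic ℝ S)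
    (hirr : P.IsIrreducible) {q : S → ℝ} (hq : IsStationaryDistribution P q) :
    IsUnit (resolventMatrix P).det := by
  rw [isUnit_iff_ne_zero]
  intro hdet
  obtain ⟨v, hv0, hv⟩ := Matrix.exists_mulVec_eq_zero_iff.2 hdet
  have hsum := stationary_dotProduct_resolventMatrix hq v
  rw [hv, dotProduct_zero] at hsum
  have hfix : P *ᵥ v = v := by
    ext i
    have := resolventMatrix_mulVec P v i
    rw [hv, ← hsum] at this
    simp only [Pi.zero_apply] at this
    linarith
  apply hv0
  ext i
  have hc : ∑ j, v j = Fintype.card S * v i := by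
    rw [Finset.sum_congr rfl fun j _ => eq_of_mulVec_eq_self hP hirr hfix j i]
    simp
  have : Nonempty S := ⟨i⟩
  have hne : (Fintype.card S : ℝ) ≠ 0 := by exact_mod_cast Fintype.card_ne_zero
  rw [hc, inv_mul_cancel_left₀ hne] at hsum
  simpa using hsum.symm

theorem poissonSolution_sub {P : Matrix S S ℝ} (hP : P ∈ Matrix.rowStochastic ℝ S)
    (hirr : P.IsIrreducible) {q : S → ℝ} (hq : IsStationaryDistribution P q) {f : S → ℝ}
    (hf : q ⬝ᵥ f = 0) (i : S) :
    poissonSolution P f i - ∑ j, P i j * poissonSolution P f j = f i := by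
  have hA : resolventMatrix P *ᵥ poissonSolution P f = f := by
    rw [poissonSolution, Matrix.mulVec_mulVec,
      Matrix.mul_nonsing_inv _ (isUnit_det_resolventMatrix hP hirr hq), Matrix.one_mulVec]
  have h0 := stationary_dotProduct_resolventMatrix hq (poissonSolution P f)
  rw [hA, hf] at h0
  have := resolventMatrix_mulVec P (poissonSolution P f) i
  rw [hA, ← h0, add_zero] at this
  exact this.symm

/-- This explicit formula transfers continuity in the parameter from the transition matrix to its
stationary distribution. -/
theorem stationary_eq {P : Matrix S S ℝ} (hP : P ∈ Matrix.rowStochastic ℝ S)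
    (hirr : P.IsIrreducible) {q : S → ℝ} (hq : IsStationaryDistribution P q) :
    q = (fun _ => (Fintype.card S : ℝ)⁻¹) ᵥ* (resolventMatrix P)⁻¹ := by
  have h : q ᵥ* resolventMatrix P = fun _ => (Fintype.card S : ℝ)⁻¹ := by
    ext j
    have := stationary_dotProduct_resolventMatrix hq (Pi.single j 1)
    rw [Matrix.dotProduct_mulVec] at this
    simpa using this
  rw [← h, Matrix.vecMul_vecMul,
    Matrix.mul_nonsing_inv _ (isUnit_det_resolventMatrix hP hirr hq), Matrix.vecMul_one]

variable {E : Type*} [TopologicalSpace E] {p : E → Matrix S S ℝ} {π : E → S → ℝ}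

theorem continuous_inv_resolventMatrix (hp : Continuous p)
    (hdet : ∀ w, IsUnit (resolventMatrix (p w)).det) :
    Continuous fun w => (resolventMatrix (p w))⁻¹ := by
  have hc : Continuous fun w => resolventMatrix (p w) := by
    unfold resolventMatrix; fun_prop
  simp only [Matrix.inv_def, Ring.inverse_eq_inv']
  exact (hc.matrix_det.inv₀ fun w => (hdet w).ne_zero).smul hc.matrix_adjugate

theorem continuous_stationary (hp : Continuous p) (hstoch : ∀ w, p w ∈ Matrix.rowStochastic ℝ S)
    (hirr : ∀ w, (p w).IsIrreducible) (hπ : ∀ w, IsStationaryDistribution (p w) (π w)) :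
    Continuous π := by
  have h := continuous_inv_resolventMatrix hp
    fun w => isUnit_det_resolventMatrix (hstoch w) (hirr w) (hπ w)
  rw [show π = _ from funext fun w => stationary_eq (hstoch w) (hirr w) (hπ w)]
  exact continuous_const.matrix_vecMul h

theorem continuous_poissonSolution (hp : Continuous p)
    (hstoch : ∀ w, p w ∈ Matrix.rowStochastic ℝ S)
    (hirr : ∀ w, (p w).IsIrreducible) (hπ : ∀ w, IsStationaryDistribution (p w) (π w))
    {f : E → S → ℝ} (hf : Continuous f) :
    Continuous fun w => poissonSolution (p w) (f w) :=
  (continuous_inv_resolventMatrix hp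
    fun w => isUnit_det_resolventMatrix (hstoch w) (hirr w) (hπ w)).matrix_mulVec hf

end Poisson

/-! ### Norm comparison and pathwise convergence -/

theorem Seminorm.continuous_pi_real {d : ℕ} (nrm : Seminorm ℝ (Fin d → ℝ)) : Continuous nrm :=
  (ConvexOn.locallyLipschitz nrm.convexOn).continuous

theorem Seminorm.exists_norm_le_of_definite {d : ℕ} (nrm : Seminorm ℝ (Fin d → ℝ))
    (hnrm : ∀ v, nrm v = 0 → v = 0) : ∃ c : ℝ, 0 < c ∧ ∀ v, ‖v‖ ≤ c * nrm v := by
  rcases (Metric.sphere (0 : Fin d → ℝ) 1).eq_empty_or_nonempty with hS | hS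
  · refine ⟨1, one_pos, fun v => ?_⟩
    by_cases hv : v = 0
    · simp [hv]
    · have hmem : ‖v‖⁻¹ • v ∈ Metric.sphere (0 : Fin d → ℝ) 1 := by
        simp [norm_smul, norm_ne_zero_iff.2 hv]
      simp [hS] at hmem
  · obtain ⟨w, hw, hmin⟩ := (isCompact_sphere (0 : Fin d → ℝ) 1).exists_isMinOn hS
      nrm.continuous_pi_real.continuousOn
    have hw1 : ‖w‖ = 1 := by simpa using hw
    have hw0 : 0 < nrm w := by
      refine lt_of_le_of_ne (apply_nonneg nrm w) fun h => ?_
      rw [hnrm w h.symm] at hw1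
      simp at hw1
    refine ⟨(nrm w)⁻¹, inv_pos.2 hw0, fun v => ?_⟩
    by_cases hv : v = 0
    · simp [hv]
    have hvn : 0 < ‖v‖ := norm_pos_iff.2 hv
    have hmem : ‖v‖⁻¹ • v ∈ Metric.sphere (0 : Fin d → ℝ) 1 := by
      simp [norm_smul, hvn.ne']
    have h : nrm w ≤ nrm (‖v‖⁻¹ • v) := hmin hmem
    rw [map_smul_eq_mul, norm_inv, norm_norm, le_inv_mul_iff₀ hvn] at h
    rw [le_inv_mul_iff₀ hw0]
    linarith

/-- A sequence with an affine contracting growth bound stays bounded. -/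
theorem exists_bound_of_affine_recursion {a u : ℕ → ℝ} (ha0 : ∀ n, 0 ≤ a n)
    (ha1 : ∀ᶠ n in atTop, a n ≤ 1) {α K : ℝ} (hα : α < 1)
    (hα0 : 0 ≤ α) (hu : ∀ᶠ n in atTop, u (n + 1) ≤ (1 - a n) * u n + a n * (K + α * u n)) :
    ∃ R : ℝ, ∀ n, u n ≤ R := by
  obtain ⟨N, hN⟩ := eventually_atTop.1 (ha1.and hu)
  -- `R` dominates the initial segment and satisfies `K + α * R ≤ R`, so it is preserved by the
  -- recursion.
  set R := (∑ i ∈ Finset.range (N + 1), |u i|) + |K| / (1 - α) with hR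
  have h1α : 0 < 1 - α := by linarith
  have hsum : ∀ i ≤ N, |u i| ≤ ∑ i ∈ Finset.range (N + 1), |u i| := fun i hi =>
    Finset.single_le_sum (f := fun i => |u i|) (fun _ _ => abs_nonneg _)
      (Finset.mem_range.2 (by omega))
  have hK0 : 0 ≤ |K| / (1 - α) := by positivity
  have hsmall : ∀ i ≤ N, u i ≤ R := fun i hi => by
    linarith [hsum i hi, le_abs_self (u i)]
  have hKR : K + α * R ≤ R := by
    have : |K| / (1 - α) ≤ R := by
      linarith [hsum 0 (Nat.zero_le _), abs_nonneg (u 0)]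
    rw [div_le_iff₀ h1α] at this
    linarith [le_abs_self K]
  refine ⟨R, fun n => ?_⟩
  rcases le_total n N with h | h
  · exact hsmall n h
  · induction n, h using Nat.le_induction with
    | base => exact hsmall N le_rfl
    | succ n hn ih =>
      obtain ⟨h1, h2⟩ := hN n hn
      have h3 : K + α * u n ≤ R :=
        (add_le_add_right (mul_le_mul_of_nonneg_left ih hα0) K).trans hKR
      have h4 := mul_le_mul_of_nonneg_left h3 (ha0 n)
      have h5 := mul_le_mul_of_nonneg_left ih (sub_nonneg.2 h1)
      linarith

/-- A stochastic approximation iteration of a map which contracts towards its fixed point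
converges as soon as the running averages of the noise vanish. -/
theorem tendsto_of_runningAverage_noise {d : ℕ} {nrm : Seminorm ℝ (Fin d → ℝ)}
    (hnrm : ∀ v, nrm v = 0 → v = 0) {a : ℕ → ℝ} (ha0 : ∀ n, 0 ≤ a n)
    (ha1 : ∀ᶠ n in atTop, a n ≤ 1) (has : ¬ Summable a) {α : ℝ} (hα0 : 0 < α) (hα1 : α < 1)
    {h : (Fin d → ℝ) → Fin d → ℝ} {z : Fin d → ℝ} (hh : ∀ v, nrm (h v - z) ≤ α * nrm (v - z))
    {x η : ℕ → Fin d → ℝ} (hx : ∀ n, x (n + 1) = x n + a n • (h (x n) + η n - x n))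
    (hη : ∀ l, Tendsto (runningAverage a fun n => η n l) atTop (𝓝 0)) :
    Tendsto x atTop (𝓝 z) := by
  obtain ⟨c, hc, hcn⟩ := nrm.exists_norm_le_of_definite hnrm
  set e : ℕ → Fin d → ℝ := fun n l => runningAverage a (fun k => η k l) n with he
  have he0 : Tendsto e atTop (𝓝 0) := tendsto_pi_nhds.2 hη
  have hne : Tendsto (fun n => nrm (e n)) atTop (𝓝 0) := by
    simpa [Function.comp_def] using (nrm.continuous_pi_real.tendsto 0).comp he0
  have hrec : ∀ n, x (n + 1) - e (n + 1) - z =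
      (1 - a n) • (x n - e n - z) + a n • (h (x n) - z) := by
    intro n
    ext l
    simp only [hx, he, runningAverage, Pi.add_apply, Pi.sub_apply, Pi.smul_apply, smul_eq_mul]
    ring
  have hα1' : 0 < 1 - α := by linarith
  have hu : Tendsto (fun n => nrm (x n - e n - z)) atTop (𝓝 0) := by
    refine tendsto_zero_of_le_contraction (b := fun n => (1 - α) * a n)
      (r := fun n => α / (1 - α) * nrm (e n)) (fun n => mul_nonneg hα1'.le (ha0 n)) ?_ ?_
      (by simpa using hne.const_mul (α / (1 - α)))
      (Eventually.of_forall fun n => apply_nonneg nrm _) ?_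
    · filter_upwards [ha1] with n h1
      nlinarith [ha0 n]
    · exact mt (summable_mul_left_iff hα1'.ne').1 has
    · filter_upwards [ha1] with n h1
      rw [hrec]
      have t1 := map_add_le_add nrm ((1 - a n) • (x n - e n - z)) (a n • (h (x n) - z))
      rw [map_smul_eq_mul, map_smul_eq_mul, Real.norm_of_nonneg (sub_nonneg.2 h1),
        Real.norm_of_nonneg (ha0 n)] at t1
      have t2 : nrm (x n - z) ≤ nrm (x n - e n - z) + nrm (e n) := by
        have := map_add_le_add nrm (x n - e n - z) (e n)
        rwa [show x n - e n - z + e n = x n - z by abel] at this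
      have t3 : nrm (h (x n) - z) ≤ α * (nrm (x n - e n - z) + nrm (e n)) :=
        (hh _).trans (mul_le_mul_of_nonneg_left t2 hα0.le)
      have t4 := mul_le_mul_of_nonneg_left t3 (ha0 n)
      have t5 : (1 - α) * a n * (α / (1 - α) * nrm (e n)) = a n * (α * nrm (e n)) := by
        field_simp
      rw [t5]
      linarith
  have hy : Tendsto (fun n => x n - e n - z) atTop (𝓝 0) :=
    squeeze_zero_norm (fun n => hcn _) (by simpa using hu.const_mul c)
  simpa using ((hy.add he0).add_const z).congr fun n => show _ = x n by abel

/-- Along a bounded slowly varying sequence, the forcing of the Poisson equation averages out if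
the corresponding one-step martingale noise does. -/
theorem tendsto_runningAverage_poisson {S E : Type*} [Finite S] [NormedAddCommGroup E]
    [ProperSpace E] {a : ℕ → ℝ} (ha : IsStepsize a) {V : E → S → ℝ} (hV : Continuous V)
    {x : ℕ → E} {y : ℕ → S} {R : ℝ} (hR : ∀ n, ‖x n‖ ≤ R)
    (hslow : Tendsto (fun n => x (n + 1) - x n) atTop (𝓝 0)) {g : ℕ → ℝ}
    (hζ : Tendsto (runningAverage a fun n => V (x n) (y (n + 1)) - g n) atTop (𝓝 0)) :
    Tendsto (runningAverage a fun n => V (x n) (y n) - g n) atTop (𝓝 0) := by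
  cases nonempty_fintype S
  have ha1 : ∀ᶠ n in atTop, a n ≤ 1 := ha.tendsto_zero.eventually (ge_mem_nhds one_pos)
  have hxmem : ∀ n, x n ∈ Metric.closedBall (0 : E) R := fun n => by simpa using hR n
  have hcomp := isCompact_closedBall (0 : E) R
  obtain ⟨C, hC⟩ := hcomp.exists_bound_of_continuousOn hV.continuousOn
  have hW := tendsto_runningAverage_of_increments (W := fun n => V (x n) (y n)) ha.nonneg
    ha.tendsto_zero ha.not_summable (eventually_atTop.2 ha.eventually_antitone)
    (C := C) fun n => (norm_le_pi_norm (V (x n)) (y n)).trans (hC _ (hxmem n))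
  have hρ0 : Tendsto (fun n => V (x (n + 1)) - V (x n)) atTop (𝓝 0) := by
    have huc := hcomp.uniformContinuousOn_of_continuous hV.continuousOn
    rw [Metric.uniformContinuousOn_iff] at huc
    rw [Metric.tendsto_nhds] at hslow ⊢
    intro ε hε
    obtain ⟨δ, hδ, hmod⟩ := huc ε hε
    filter_upwards [hslow δ hδ] with n hn
    rw [dist_zero_right, ← dist_eq_norm] at hn ⊢
    exact hmod _ (hxmem _) _ (hxmem _) hn
  have hρ : Tendsto (runningAverage a fun n => V (x (n + 1)) (y (n + 1)) - V (x n) (y (n + 1)))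
      atTop (𝓝 0) := by
    refine tendsto_runningAverage_of_tendsto ha.nonneg ha1 ha.not_summable ?_
    refine squeeze_zero_norm (fun n => ?_) (tendsto_zero_iff_norm_tendsto_zero.1 hρ0)
    exact norm_le_pi_norm (V (x (n + 1)) - V (x n)) (y (n + 1))
  -- The three pieces are the one-step noise, the increment of `V (x n) (y n)`, and the drift of `V`
  -- in its first argument.
  have hsum := (hζ.add hW).add hρ
  simp only [← runningAverage_add, add_zero] at hsum
  refine hsum.congr fun n => ?_
  congr 1
  ext k
  ring

/-! ### Controlled Markov noise -/

section Noise

variable {Ω S : Type*} [MeasurableSpace S] {d : ℕ} {Y : ℕ → Ω → S} {x : ℕ → Ω → Fin d → ℝ}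

theorem chainSigma_mono (Y : ℕ → Ω → S) (x : ℕ → Ω → Fin d → ℝ) : Monotone (chainSigma Y x) :=
  fun _ _ h => iSup₂_le fun m hm => le_iSup₂_of_le m (hm.trans h) le_rfl

theorem measurable_chainSigma_noise (Y : ℕ → Ω → S) (x : ℕ → Ω → Fin d → ℝ) (n : ℕ) :
    Measurable[chainSigma Y x n] (Y n) :=
  (comap_measurable (Y n)).mono (le_iSup₂_of_le n le_rfl le_sup_left) le_rfl

theorem measurable_chainSigma_iterate (Y : ℕ → Ω → S) (x : ℕ → Ω → Fin d → ℝ) (n : ℕ) :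
    Measurable[chainSigma Y x n] (x n) :=
  (comap_measurable (x n)).mono (le_iSup₂_of_le n le_rfl le_sup_right) le_rfl

variable [mΩ : MeasurableSpace Ω] {μ : Measure Ω}

theorem chainSigma_le (hY : ∀ n, Measurable (Y n)) (hx : ∀ n, Measurable (x n)) (n : ℕ) :
    chainSigma Y x n ≤ mΩ :=
  iSup₂_le fun m _ => sup_le (hY m).comap_le (hx m).comap_le

variable [Fintype S] [MeasurableSingletonClass S]

theorem measurable_uncurry_of_continuous {V : (Fin d → ℝ) → S → ℝ} (hV : Continuous V) :
    Measurable fun q : (Fin d → ℝ) × S => V q.1 q.2 :=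
  measurable_from_prod_countable_left fun j => ((continuous_apply j).comp hV).measurable

variable [DecidableEq S]

/-- The one-step noise of a function of a controlled Markov chain averages out on the event that
the iterates stay in a fixed ball. -/
theorem ae_tendsto_runningAverage_markov [IsProbabilityMeasure μ] {a : ℕ → ℝ} (ha : IsStepsize a)
    {p : (Fin d → ℝ) → Matrix S S ℝ} (hp : Continuous p)
    (hstoch : ∀ w, p w ∈ Matrix.rowStochastic ℝ S)
    (hY : ∀ n, Measurable (Y n)) (hx : ∀ n, Measurable (x n))
    (hMarkov : ∀ (n : ℕ) (j : S),
      μ[(Y (n + 1) ⁻¹' {j}).indicator (fun _ => (1 : ℝ)) | chainSigma Y x n]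
        =ᵐ[μ] fun ω => p (x n ω) (Y n ω) j)
    {V : (Fin d → ℝ) → S → ℝ} (hV : Continuous V) (R : ℝ) :
    ∀ᵐ ω ∂μ, (∀ n, ‖x n ω‖ ≤ R) → Tendsto (runningAverage a fun n =>
      V (x n ω) (Y (n + 1) ω) - ∑ j, p (x n ω) (Y n ω) j * V (x n ω) j) atTop (𝓝 0) := by
  -- Cutting off outside the ball gives bounded adapted multipliers without assuming bounded
  -- iterates; on the event in question the cut-off is inactive.
  set φ : S → (Fin d → ℝ) → ℝ := fun j =>
    (Metric.closedBall (0 : Fin d → ℝ) R).indicator fun v => V v j with hφ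
  have hφm : ∀ j, Measurable (φ j) := fun j =>
    (((continuous_apply j).comp hV).measurable).indicator Metric.isClosed_closedBall.measurableSet
  obtain ⟨C, hC⟩ := (isCompact_closedBall (0 : Fin d → ℝ) R).exists_bound_of_continuousOn
    hV.continuousOn
  have hφC : ∀ j v, |φ j v| ≤ |C| := by
    intro j v
    by_cases hv : v ∈ Metric.closedBall (0 : Fin d → ℝ) R
    · rw [hφ]
      simp only [Set.indicator_of_mem hv]
      exact ((norm_le_pi_norm (V v) j).trans (hC v hv)).trans (le_abs_self C)
    · simp [hφ, Set.indicator_of_notMem hv]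
  have hpm : ∀ j, Measurable fun q : (Fin d → ℝ) × S => p q.1 q.2 j := fun j =>
    measurable_uncurry_of_continuous (V := fun v i => p v i j) (by fun_prop)
  have hpn : ∀ n j, Measurable[chainSigma Y x n] fun ω => p (x n ω) (Y n ω) j := fun n j =>
    (hpm j).comp ((measurable_chainSigma_iterate Y x n).prodMk (measurable_chainSigma_noise Y x n))
  set ξ : S → ℕ → Ω → ℝ := fun j n ω =>
    (Y (n + 1) ⁻¹' {j}).indicator (fun _ => (1 : ℝ)) ω - p (x n ω) (Y n ω) j with hξ
  have hind : ∀ n j, Measurable[chainSigma Y x (n + 1)]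
      ((Y (n + 1) ⁻¹' {j}).indicator fun _ => (1 : ℝ)) := fun n j =>
    measurable_const.indicator (measurable_chainSigma_noise Y x (n + 1) (measurableSet_singleton j))
  have hξm : ∀ j n, Measurable[chainSigma Y x (n + 1)] (ξ j n) := fun j n =>
    (hind n j).sub ((hpn n j).mono (chainSigma_mono Y x n.le_succ) le_rfl)
  have hξ1 : ∀ j n ω, |ξ j n ω| ≤ 1 := by
    intro j n ω
    have h0 := (hstoch (x n ω)).1 (Y n ω) j
    have h1 := Matrix.le_one_of_mem_rowStochastic (hstoch (x n ω)) (i := Y n ω) (j := j)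
    simp only [hξ, Set.indicator]
    rw [abs_le]
    split_ifs <;> constructor <;> linarith
  have hle := chainSigma_le hY hx
  have hξi : ∀ j n, Integrable (ξ j n) μ := fun j n =>
    Integrable.of_bound ((hξm j n).mono (hle _) le_rfl).aestronglyMeasurable 1
      (ae_of_all _ (hξ1 j n))
  have hξ0 : ∀ j n, μ[ξ j n | chainSigma Y x n] =ᵐ[μ] 0 := by
    intro j n
    have hpi : Integrable (fun ω => p (x n ω) (Y n ω) j) μ :=
      Integrable.of_bound ((hpn n j).mono (hle _) le_rfl).aestronglyMeasurable 1
        (ae_of_all _ fun ω => by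
          rw [Real.norm_of_nonneg ((hstoch (x n ω)).1 _ _)]
          exact Matrix.le_one_of_mem_rowStochastic (hstoch (x n ω)))
    have hii : Integrable ((Y (n + 1) ⁻¹' {j}).indicator fun _ => (1 : ℝ)) μ :=
      (integrable_const 1).indicator (hY (n + 1) (measurableSet_singleton j))
    have h1 := condExp_sub hii hpi (chainSigma Y x n)
    rw [condExp_of_stronglyMeasurable (hle n) (hpn n j).stronglyMeasurable hpi] at h1
    filter_upwards [h1, hMarkov n j] with ω e1 e2
    have e3 : (μ[ξ j n | chainSigma Y x n]) ω = _ := e1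
    rw [e3, Pi.sub_apply, e2, sub_self, Pi.zero_apply]
  have hterm : ∀ j, ∀ᵐ ω ∂μ, Tendsto (runningAverage a fun n => φ j (x n ω) * ξ j n ω) atTop
      (𝓝 0) := by
    intro j
    have hφn : ∀ n, Measurable[chainSigma Y x n] fun ω => φ j (x n ω) := fun n =>
      (hφm j).comp (measurable_chainSigma_iterate Y x n)
    refine ae_tendsto_runningAverage (ε := fun n ω => φ j (x n ω) * ξ j n ω) (C := |C| * 1) ha hle
      (chainSigma_mono Y x) (fun n => ?_) (fun n => ae_of_all _ fun ω => ?_) fun n => ?_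
    · exact ((hφn n).mono (chainSigma_mono Y x n.le_succ) le_rfl).mul (hξm j n)
    · rw [abs_mul]
      exact mul_le_mul (hφC j _) (hξ1 j n ω) (abs_nonneg _) (abs_nonneg _)
    · have := condExp_stronglyMeasurable_mul_of_bound (hle n) (hφn n).stronglyMeasurable (hξi j n)
        |C| (ae_of_all _ fun ω => hφC j _)
      filter_upwards [this, hξ0 j n] with ω e1 e2
      have e3 : (μ[fun ω => φ j (x n ω) * ξ j n ω | chainSigma Y x n]) ω = _ := e1
      rw [e3, Pi.mul_apply, e2, Pi.zero_apply, mul_zero]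
  filter_upwards [ae_all_iff.2 hterm] with ω hω hb
  have hsum : ∀ (s : Finset S) (n : ℕ), runningAverage a (fun k => ∑ j ∈ s, φ j (x k ω) * ξ j k ω) n
      = ∑ j ∈ s, runningAverage a (fun k => φ j (x k ω) * ξ j k ω) n := by
    intro s n
    induction n with
    | zero => simp [runningAverage]
    | succ n ih => simp only [runningAverage, ih, Finset.mul_sum, Finset.sum_add_distrib]
  have hlim := tendsto_finsetSum Finset.univ fun j _ => hω j
  simp only [Finset.sum_const_zero, ← hsum] at hlim
  refine hlim.congr fun n => ?_
  congr 1
  ext k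
  have hmem : x k ω ∈ Metric.closedBall (0 : Fin d → ℝ) R := by simpa using hb k
  simp only [hφ, hξ, Set.indicator_of_mem hmem, mul_sub, Finset.sum_sub_distrib]
  congr 1
  · simp [Set.indicator, eq_comm]
  · exact Finset.sum_congr rfl fun j _ => mul_comm _ _

end Noise

/-! ### Martingale noise along the iterates -/

section Martingale

variable {Ω S : Type*} [MeasurableSpace S] {d : ℕ} {x₀ : Ω → Fin d → ℝ}
  {Y : ℕ → Ω → S} {M : ℕ → (Fin d → ℝ) → Ω → Fin d → ℝ}

theorem noiseSigma_mono (x₀ : Ω → Fin d → ℝ) (Y : ℕ → Ω → S)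
    (M : ℕ → (Fin d → ℝ) → Ω → Fin d → ℝ) : Monotone (noiseSigma x₀ Y M) :=
  fun _ _ h => sup_le_sup
    (sup_le_sup le_rfl (iSup₂_le fun m hm => le_iSup₂_of_le m (hm.trans h) le_rfl))
    (iSup₂_le fun m hm => le_iSup₂_of_le m (hm.trans h) le_rfl)

theorem noiseSigma_le [mΩ : MeasurableSpace Ω] (hx₀ : Measurable x₀) (hY : ∀ n, Measurable (Y n))
    (hM : ∀ n v, Measurable (M n v)) (n : ℕ) : noiseSigma x₀ Y M n ≤ mΩ :=
  sup_le (sup_le hx₀.comap_le (iSup₂_le fun m _ => (hY m).comap_le))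
    (iSup₂_le fun m _ => iSup_le fun v => (hM m v).comap_le)

/-- The iterates are adapted to the noise filtration. -/
theorem measurable_noiseSigma_iterate [Finite S] [MeasurableSingletonClass S]
    {F : (Fin d → ℝ) → S → Fin d → ℝ} (hF : Continuous F) {a : ℕ → ℝ} {x : ℕ → Ω → Fin d → ℝ}
    (hx : ∀ n ω, x (n + 1) ω =
      x n ω + a n • (F (x n ω) (Y n ω) - x n ω + M (n + 1) (x n ω) ω))
    (hM_adapted : ∀ n : ℕ,
      Measurable[noiseSigma (x 0) Y M (n + 1)] fun ω => M (n + 1) (x n ω) ω) (n : ℕ) :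
    Measurable[noiseSigma (x 0) Y M n] (x n) := by
  induction n with
  | zero => exact (comap_measurable (x 0)).mono (le_sup_left.trans le_sup_left) le_rfl
  | succ n ih =>
    have hmono := noiseSigma_mono (x 0) Y M n.le_succ
    have hYn : Measurable[noiseSigma (x 0) Y M n] (Y n) := by
      refine (comap_measurable (Y n)).mono (le_trans ?_ (le_sup_right.trans le_sup_left)) le_rfl
      exact le_iSup₂_of_le (f := fun m (_ : m ≤ n) => MeasurableSpace.comap (Y m) inferInstance)
        n le_rfl le_rfl
    have hFm : Measurable fun q : (Fin d → ℝ) × S => F q.1 q.2 :=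
      measurable_from_prod_countable_left fun j => ((continuous_apply j).comp hF).measurable
    have hFn : Measurable[noiseSigma (x 0) Y M (n + 1)] fun ω => F (x n ω) (Y n ω) :=
      (hFm.comp (ih.prodMk hYn)).mono hmono le_rfl
    have hxn : Measurable[noiseSigma (x 0) Y M (n + 1)] (x n) := ih.mono hmono le_rfl
    have h := hxn.add (((hFn.sub hxn).add (hM_adapted n)).const_smul (a n))
    rwa [show x (n + 1) = _ from funext (hx n)]

/-- The martingale noise averages out on the event that the iterates stay in a fixed ball. -/
theorem ae_tendsto_runningAverage_martingale [mΩ : MeasurableSpace Ω] {μ : Measure Ω}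
    [IsProbabilityMeasure μ] {nrm : Seminorm ℝ (Fin d → ℝ)} {a : ℕ → ℝ} (ha : IsStepsize a)
    {G : ℕ → MeasurableSpace Ω} (hle : ∀ n, G n ≤ mΩ) (hG : Monotone G)
    {x : ℕ → Ω → Fin d → ℝ} (hx : ∀ n, Measurable[G n] (x n))
    {N : ℕ → Ω → Fin d → ℝ} (hN : ∀ n, Measurable[G (n + 1)] (N n)) {R : ℝ}
    (hmds : ∀ n, μ[{ω | nrm (x n ω) ≤ R}.indicator (N n) | G n] =ᵐ[μ] 0)
    {K₀ : ℝ} (hK₀ : 0 ≤ K₀) (hbound : ∀ᵐ ω ∂μ, ∀ n l, |N n ω l| ≤ K₀ * (1 + nrm (x n ω)))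
    (l : Fin d) :
    ∀ᵐ ω ∂μ, (∀ n, nrm (x n ω) ≤ R) →
      Tendsto (runningAverage a fun n => N n ω l) atTop (𝓝 0) := by
  set D : ℕ → Set Ω := fun n => {ω | nrm (x n ω) ≤ R} with hD
  have hDm : ∀ n, MeasurableSet[G n] (D n) := fun n =>
    (nrm.continuous_pi_real.measurable.comp (hx n)) measurableSet_Iic
  have hZm : ∀ n, Measurable[G (n + 1)] ((D n).indicator (N n)) := fun n =>
    (hN n).indicator (hG n.le_succ _ (hDm n))
  have hcoord : ∀ n, Measurable[G (n + 1)] fun ω => (D n).indicator (N n) ω l := fun n =>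
    (measurable_pi_apply l).comp (hZm n)
  have hb : ∀ᵐ ω ∂μ, ∀ n l, |(D n).indicator (N n) ω l| ≤ |K₀ * (1 + R)| := by
    filter_upwards [hbound] with ω h n l
    by_cases hω : ω ∈ D n
    · rw [Set.indicator_of_mem hω]
      refine (h n l).trans ((mul_le_mul_of_nonneg_left ?_ hK₀).trans (le_abs_self _))
      have : nrm (x n ω) ≤ R := hω
      linarith
    · simp only [Set.indicator_of_notMem hω, Pi.zero_apply, abs_zero]
      exact abs_nonneg (K₀ * (1 + R))
  have hint : ∀ n, Integrable ((D n).indicator (N n)) μ := fun n =>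
    Integrable.of_bound ((hZm n).mono (hle _) le_rfl).aestronglyMeasurable |K₀ * (1 + R)| (by
      filter_upwards [hb] with ω h
      exact (pi_norm_le_iff_of_nonneg (abs_nonneg _)).2 (h n))
  have hlim := ae_tendsto_runningAverage (ε := fun n ω => (D n).indicator (N n) ω l) ha hle hG
    hcoord (C := |K₀ * (1 + R)|) (fun n => by filter_upwards [hb] with ω h using h n l) (fun n => by
      have h := (ContinuousLinearMap.proj (R := ℝ) (φ := fun _ : Fin d => ℝ) l).comp_condExp_comm
        (m := G n) (hint n)
      filter_upwards [h, hmds n] with ω e1 e2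
      have e3 : (μ[fun ω => (D n).indicator (N n) ω l | G n]) ω = _ := e1.symm
      rw [e3, Function.comp_apply, e2]
      simp)
  filter_upwards [hlim] with ω hω hR
  refine hω.congr fun n => ?_
  congr 1
  ext k
  have hmem : ω ∈ D k := hR k
  rw [Set.indicator_of_mem hmem]

end Martingale
-- Assembly of the convergence theorem
theorem mainTheorem2
    {Ω S : Type*} [mΩ : MeasurableSpace Ω] (μ : Measure Ω) [IsProbabilityMeasure μ]
    [Fintype S] [DecidableEq S] [MeasurableSpace S] [MeasurableSingletonClass S]
    (d : ℕ)
    -- an arbitrary norm on `ℝᵈ`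
    (nrm : Seminorm ℝ (Fin d → ℝ)) (hnrm : ∀ v, nrm v = 0 → v = 0)
    -- stepsizes
    (a : ℕ → ℝ) (ha : IsStepsize a)
    -- the controlled transition probabilities `p w i j = p_w(j | i)`
    (p : (Fin d → ℝ) → Matrix S S ℝ)
    (hp_stoch : ∀ w, p w ∈ Matrix.rowStochastic ℝ S)
    (hp_irred : ∀ w, (p w).IsIrreducible)
    (L₁ : ℝ) (hL₁ : 0 < L₁)
    (hp_lip : ∀ (i : S) (w v : Fin d → ℝ), ∑ j, |p w i j - p v i j| ≤ L₁ * nrm (w - v))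
    -- their stationary distributions
    (π : (Fin d → ℝ) → S → ℝ) (hπ : ∀ w, IsStationaryDistribution (p w) (π w))
    -- the map `F`
    (F : (Fin d → ℝ) → S → Fin d → ℝ)
    (α : ℝ) (hα : α ∈ Set.Ioo (0 : ℝ) 1)
    (hF_contr : ∀ x z w : Fin d → ℝ, nrm (∑ i, π w i • (F x i - F z i)) ≤ α * nrm (x - z))
    (xstar : Fin d → ℝ) (hxstar : ∀ w, ∑ i, π w i • F xstar i = xstar)
    (L₃ : ℝ) (hL₃ : 0 < L₃)
    (hF_lip : ∀ (i : S) (l : Fin d) (x z : Fin d → ℝ), |F x i l - F z i l| ≤ L₃ * nrm (x - z))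
    -- the processes and the iteration
    (Y : ℕ → Ω → S) (hY : ∀ n, Measurable (Y n))
    (M : ℕ → (Fin d → ℝ) → Ω → Fin d → ℝ) (hM : ∀ n v, Measurable (M n v))
    (x : ℕ → Ω → Fin d → ℝ) (hx₀ : Measurable (x 0))
    (hx : ∀ n ω, x (n + 1) ω =
      x n ω + a n • (F (x n ω) (Y n ω) - x n ω + M (n + 1) (x n ω) ω))
    -- `Y` is Markov noise controlled by `x`
    (hMarkov : ∀ (n : ℕ) (j : S),
      μ[(Y (n + 1) ⁻¹' {j}).indicator (fun _ => (1 : ℝ)) | chainSigma Y x n]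
        =ᵐ[μ] fun ω => p (x n ω) (Y n ω) j)
    -- martingale difference property: for every fixed parameter, and along the iterates
    (hMDS : ∀ (n : ℕ) (v : Fin d → ℝ), μ[M (n + 1) v | noiseSigma (x 0) Y M n] =ᵐ[μ] 0)
    (hM_adapted : ∀ n : ℕ,
      Measurable[noiseSigma (x 0) Y M (n + 1)] fun ω => M (n + 1) (x n ω) ω)
    (hMDS_iter : ∀ (n : ℕ) (R : ℝ),
      μ[{ω | nrm (x n ω) ≤ R}.indicator (fun ω => M (n + 1) (x n ω) ω) |
        noiseSigma (x 0) Y M n] =ᵐ[μ] 0)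
    -- growth bounds
    (K₀ : ℝ) (hK₀ : 0 < K₀)
    (hM_bound : ∀ᵐ ω ∂μ, ∀ (n : ℕ) (v : Fin d → ℝ) (l : Fin d),
      |M (n + 1) v ω l| ≤ K₀ * (1 + nrm v))
    (K : ℝ)
    (hF_bound : ∀ᵐ ω ∂μ, ∀ (n : ℕ) (v : Fin d → ℝ),
      nrm (F v (Y n ω) + M (n + 1) v ω) ≤ K + α * nrm v) :
    ∀ᵐ ω ∂μ, Tendsto (fun n => x n ω) atTop (𝓝 xstar) := by
  classical
  obtain ⟨hα0, hα1⟩ := hα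
  have hnc := nrm.continuous_pi_real
  obtain ⟨c, hc, hcn⟩ := nrm.exists_norm_le_of_definite hnrm
  have hsub : ∀ v : Fin d → ℝ, Tendsto (fun w => nrm (w - v)) (𝓝 v) (𝓝 0) := fun v => by
    have : Continuous fun w => nrm (w - v) := hnc.comp (continuous_id.sub continuous_const)
    simpa using this.tendsto v
  have hpc : Continuous p := by
    refine continuous_matrix fun i j => continuous_iff_continuousAt.2 fun v => ?_
    refine tendsto_iff_norm_sub_tendsto_zero.2 (squeeze_zero (fun _ => norm_nonneg _) (fun w => ?_)
      (by simpa using (hsub v).const_mul L₁))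
    exact (Finset.single_le_sum (f := fun j => |p w i j - p v i j|) (fun _ _ => abs_nonneg _)
      (Finset.mem_univ j)).trans (hp_lip i w v)
  have hFc : Continuous F := by
    refine continuous_pi fun i => continuous_pi fun l => continuous_iff_continuousAt.2 fun v => ?_
    exact tendsto_iff_norm_sub_tendsto_zero.2 (squeeze_zero (fun _ => norm_nonneg _)
      (fun w => hF_lip i l w v) (by simpa using (hsub v).const_mul L₃))
  have hπc := continuous_stationary hpc hp_stoch hp_irred hπ
  set h : (Fin d → ℝ) → Fin d → ℝ := fun w => ∑ i, π w i • F w i with hh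
  have hhc : Continuous h := by fun_prop
  -- The weights in `h v` also depend on `v`, so the hypothesis is used at `w = v`; it yields
  -- contraction towards `xstar` only, not between arbitrary points.
  have hcontr : ∀ v, nrm (h v - xstar) ≤ α * nrm (v - xstar) := fun v => by
    have e : h v - xstar = ∑ i, π v i • (F v i - F xstar i) := by
      simp only [smul_sub, Finset.sum_sub_distrib, hxstar v, hh]
    rw [e]
    exact hF_contr v xstar v
  set f : Fin d → (Fin d → ℝ) → S → ℝ := fun l w i => F w i l - h w l with hf
  have hfc : ∀ l, Continuous (f l) := fun l => by fun_prop
  set V : Fin d → (Fin d → ℝ) → S → ℝ := fun l w => poissonSolution (p w) (f l w) with hV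
  have hVc : ∀ l, Continuous (V l) := fun l =>
    continuous_poissonSolution hpc hp_stoch hp_irred hπ (hfc l)
  have hpoisson : ∀ l w i, V l w i - ∑ j, p w i j * V l w j = F w i l - h w l := fun l w i => by
    refine poissonSolution_sub (hp_stoch w) (hp_irred w) (hπ w) ?_ i
    simp [dotProduct, hf, hh, mul_sub, Finset.sum_sub_distrib, ← Finset.sum_mul, (hπ w).1.2]
  have hle := noiseSigma_le (x₀ := x 0) hx₀ hY hM
  have hxad := measurable_noiseSigma_iterate hFc hx hM_adapted
  have hxm : ∀ n, Measurable (x n) := fun n => (hxad n).mono (hle n) le_rfl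
  have ha1 : ∀ᶠ n in atTop, a n ≤ 1 := ha.tendsto_zero.eventually (ge_mem_nhds one_pos)
  -- Natural radii keep the exceptional set null, although the bound on a path is random.
  have hmart : ∀ᵐ ω ∂μ, ∀ (R : ℕ) (l : Fin d), (∀ n, nrm (x n ω) ≤ R) →
      Tendsto (runningAverage a fun n => M (n + 1) (x n ω) ω l) atTop (𝓝 0) :=
    ae_all_iff.2 fun R => ae_all_iff.2 fun l =>
      ae_tendsto_runningAverage_martingale ha hle (noiseSigma_mono (x 0) Y M) hxad hM_adapted
        (fun n => hMDS_iter n R) hK₀.le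
        (by filter_upwards [hM_bound] with ω hω n l using hω n (x n ω) l) l
  have hmark : ∀ᵐ ω ∂μ, ∀ (R : ℕ) (l : Fin d), (∀ n, ‖x n ω‖ ≤ R) →
      Tendsto (runningAverage a fun n => V l (x n ω) (Y (n + 1) ω) -
        ∑ j, p (x n ω) (Y n ω) j * V l (x n ω) j) atTop (𝓝 0) :=
    ae_all_iff.2 fun R => ae_all_iff.2 fun l =>
      ae_tendsto_runningAverage_markov ha hpc hp_stoch hY hxm hMarkov (hVc l) R
  filter_upwards [hmart, hmark, hF_bound] with ω hω1 hω2 hω3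
  have hstep : ∀ n, x (n + 1) ω =
      (1 - a n) • x n ω + a n • (F (x n ω) (Y n ω) + M (n + 1) (x n ω) ω) := fun n => by
    rw [hx]; module
  obtain ⟨B, hB⟩ := exists_bound_of_affine_recursion (u := fun n => nrm (x n ω)) (K := K) ha.nonneg
    ha1 hα1 hα0.le (by
      filter_upwards [ha1] with n h1
      have t := map_add_le_add nrm ((1 - a n) • x n ω)
        (a n • (F (x n ω) (Y n ω) + M (n + 1) (x n ω) ω))
      rw [map_smul_eq_mul, map_smul_eq_mul, Real.norm_of_nonneg (sub_nonneg.2 h1),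
        Real.norm_of_nonneg (ha.nonneg n), ← hstep] at t
      exact t.trans (add_le_add_right
        (mul_le_mul_of_nonneg_left (hω3 n (x n ω)) (ha.nonneg n)) _))
  obtain ⟨R₁, hR₁⟩ := exists_nat_ge B
  obtain ⟨R₂, hR₂⟩ := exists_nat_ge (c * B)
  have hxR₂ : ∀ n, ‖x n ω‖ ≤ R₂ := fun n =>
    (hcn _).trans ((mul_le_mul_of_nonneg_left (hB n) hc.le).trans hR₂)
  have hslow : Tendsto (fun n => x (n + 1) ω - x n ω) atTop (𝓝 0) := by
    refine squeeze_zero_norm (a := fun n => c * (a n * (K + α * B + B))) (fun n => ?_)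
      (by simpa using (ha.tendsto_zero.mul_const (K + α * B + B)).const_mul c)
    have e : x (n + 1) ω - x n ω =
        a n • (F (x n ω) (Y n ω) + M (n + 1) (x n ω) ω - x n ω) := by
      rw [hx]; module
    refine (hcn _).trans (mul_le_mul_of_nonneg_left ?_ hc.le)
    rw [e, map_smul_eq_mul, Real.norm_of_nonneg (ha.nonneg n)]
    refine mul_le_mul_of_nonneg_left ?_ (ha.nonneg n)
    refine (map_sub_le_add nrm _ _).trans (add_le_add ((hω3 n _).trans ?_) (hB n))
    exact add_le_add_right (mul_le_mul_of_nonneg_left (hB n) hα0.le) K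
  refine tendsto_of_runningAverage_noise hnrm ha.nonneg ha1 ha.not_summable hα0 hα1 hcontr
    (η := fun n => F (x n ω) (Y n ω) - h (x n ω) + M (n + 1) (x n ω) ω) (fun n => ?_) fun l => ?_
  · rw [hx]; module
  · have hξ := tendsto_runningAverage_poisson ha (hVc l) (x := fun n => x n ω)
      (y := fun n => Y n ω) hxR₂ hslow (hω2 R₂ l hxR₂)
    have hsum := hξ.add (hω1 R₁ l fun n => (hB n).trans hR₁)
    simp only [hpoisson, ← runningAverage_add, add_zero] at hsum
    exact hsum
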